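/- All algebraic groups are linear algebraic groups over $\mathbb{C}$; a group is diagonalizable if it is isomorphic to a closed subgroup of $(\mathbb{C}^*)^n$ for some $n$, and unipotent if it is isomorphic to a closed subgroup of the group of upper unitriangular $n\times n$ matrices for some $n$. Let $G$ be a group and let $\rho\colon G\to T$ be a homomorphism with Zariski dense image into (the group of complex points of) a diagonalizable group $T$. A solvable representation of $G$ relative to $\rho$ is an algebraic group $S$ with a homomorphism $\varphi\colon G\to S$ with Zariski dense image and an exact sequence of algebraic groups $1\to U\to S\xrightarrow{\pi} T\to 1$ with $U$ unipotent and $\pi\circ\varphi=\rho$. A morphism of such representations is a homomorphism $S\to S'$ of algebraic groups commuting with the maps from $G$ and the maps to $T$. The solvable completion $\mathcal{S}_\rho(G)$ is the proalgebraic group (affine group scheme over $\mathbb{C}$) that is the inverse limit of all solvable representations of $G$ relative to $\rho$. **Proposition.** Let $G$ be a finitely generated abelian group, let $m$ be its free rank, that is, the rank of $G$ modulo torsion, and let $\rho\colon G\to T$ be a homomorphism with Zariski dense image into a diagonalizable group $T$. Then there is an isomorphism of group schemes over $\mathbb{C}$ $$\mathcal{S}_\rho(G)\;\cong\;\mathbb{G}_a^m\times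 T,$$ under which the canonical projection $\mathcal{S}_\rho(G)\to T$ corresponds to the projection onto the second factor. -/

import Mathlib

universe u v w

noncomputable section

namespace SolvComp

open scoped TensorProduct

/-!
An affine group scheme over `ℂ` is given by its coordinate ring, a commutative Hopf algebra over
`ℂ`; a linear algebraic group is one whose coordinate ring is finitely generated.  Homomorphisms of
affine groups `S → S'` are the homomorphisms of bialgebras `𝒪(S') →ₐc[ℂ] 𝒪(S)`.
-/

/-- The set `S(R)` of `R`-valued points of the affine group `S` over `ℂ` with coordinate ring `A`.
Its group law is convolution, `(x * y) a = ∑ x a₍₁₎ * y a₍₂₎`. -/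
def Points (A : Type v) [CommRing A] [HopfAlgebra ℂ A] (R : Type w) [CommRing R] [Algebra ℂ R] :
    Type (max v w) :=
  WithConv (A →ₐ[ℂ] R)

namespace Points

section

variable {A : Type v} [CommRing A] [HopfAlgebra ℂ A] {A' : Type v} [CommRing A'] [HopfAlgebra ℂ A']
  {R : Type w} [CommRing R] [Algebra ℂ R] {R' : Type w} [CommRing R'] [Algebra ℂ R']

/-- The evaluation homomorphism at a point. -/
def eval (x : Points A R) : A →ₐ[ℂ] R := WithConv.ofConv x

/-- The point with a given evaluation homomorphism. -/
def mk (x : A →ₐ[ℂ] R) : Points A R := WithConv.toConv x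

@[ext]
theorem ext {x y : Points A R} (h : ∀ a, x.eval a = y.eval a) : x = y :=
  WithConv.ofConv_injective (AlgHom.ext h)

@[simp]
theorem eval_mk (x : A →ₐ[ℂ] R) : (mk x).eval = x := rfl

instance : Monoid (Points A R) := inferInstanceAs (Monoid (WithConv (A →ₐ[ℂ] R)))

theorem eval_mul (x y : Points A R) :
    (x * y).eval = (Algebra.TensorProduct.lmul' ℂ).comp
      ((Algebra.TensorProduct.map x.eval y.eval).comp (Bialgebra.comulAlgHom ℂ A)) := rfl

theorem eval_one : (1 : Points A R).eval =
    (Algebra.ofId ℂ R).comp (Bialgebra.counitAlgHom ℂ A) := rfl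

instance : Inv (Points A R) := ⟨fun x => mk (x.eval.comp (HopfAlgebra.antipodeAlgHom ℂ A))⟩

theorem eval_inv (x : Points A R) :
    (x⁻¹).eval = x.eval.comp (HopfAlgebra.antipodeAlgHom ℂ A) := rfl

instance : Group (Points A R) where
  inv_mul_cancel x := by
    ext a
    have h : ((Algebra.TensorProduct.lmul' ℂ).comp (Algebra.TensorProduct.map
          (x.eval.comp (HopfAlgebra.antipodeAlgHom ℂ A)) x.eval)) =
        x.eval.comp ((Algebra.TensorProduct.lmul' ℂ).comp (Algebra.TensorProduct.map
          (HopfAlgebra.antipodeAlgHom ℂ A) (AlgHom.id ℂ A))) := by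
      ext <;> simp
    rw [eval_mul, eval_inv, ← AlgHom.comp_assoc, h, eval_one]
    have h2 := HopfAlgebra.mul_antipode_rTensor_comul_apply (R := ℂ) a
    have h3 := congrArg x.eval h2
    rw [AlgHom.commutes] at h3
    exact h3

/-- The homomorphism `S(R) → S(R')` induced by a homomorphism of `ℂ`-algebras `R → R'`. -/
def map (f : R →ₐ[ℂ] R') : Points A R →* Points A R' where
  toFun x := mk (f.comp x.eval)
  map_one' := by ext a; simp [eval_one, Algebra.ofId_apply]
  map_mul' x y := WithConv.ofConv_injective (AlgHom.comp_convMul_distrib f x y)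

/-- The homomorphism `S(R) → S'(R)` induced by the homomorphism of affine groups `S → S'` with
comorphism `f : 𝒪(S') → 𝒪(S)`. -/
def comap (f : A' →ₐc[ℂ] A) : Points A R →* Points A' R where
  toFun x := mk (x.eval.comp (f : A' →ₐ[ℂ] A))
  map_one' := by ext a; simp [eval_one]
  map_mul' x y := WithConv.ofConv_injective (AlgHom.convMul_comp_bialgHom_distrib x y f)

end

end Points

/-- A homomorphism from an abstract group `G` to `S(ℂ)` has Zariski dense image: the only regular
function on `S` that vanishes on the image is `0`. -/
def IsZariskiDense {G : Type u} [Group G] {A : Type v} [CommRing A] [HopfAlgebra ℂ A]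
    (φ : G →* Points A ℂ) : Prop :=
  ∀ a : A, (∀ g : G, (φ g).eval a = 0) → a = 0

/-- The affine group with coordinate ring `B` is diagonalizable: it is isomorphic to a closed
subgroup of the torus `(ℂˣ)ⁿ`, whose coordinate ring is the group algebra of `ℤⁿ`. -/
def IsDiagonalizable (B : Type v) [CommRing B] [HopfAlgebra ℂ B] : Prop :=
  ∃ (n : ℕ) (f : AddMonoidAlgebra ℂ (Fin n → ℤ) →ₐc[ℂ] B), Function.Surjective f

/-- The affine group `U` with coordinate ring `C` is a unipotent algebraic group: it is isomorphic
to a closed subgroup of the group of upper unitriangular `n × n` matrices.  Such a closed embedding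
is the same thing as a homomorphism to that group, that is, a unitriangular matrix `M` over `C`
which is multiplicative, whose entries generate `C`. -/
def IsUnipotent (C : Type v) [CommRing C] [HopfAlgebra ℂ C] : Prop :=
  ∃ (n : ℕ) (M : Matrix (Fin n) (Fin n) C),
    (∀ i, M i i = 1) ∧ (∀ i j, j < i → M i j = 0) ∧
    (∀ i j, Coalgebra.comul (R := ℂ) (M i j) = ∑ k, M i k ⊗ₜ[ℂ] M k j) ∧
    (∀ i j, Coalgebra.counit (R := ℂ) (M i j) = if i = j then 1 else 0) ∧
    Algebra.adjoin ℂ (Set.range fun p : Fin n × Fin n => M p.1 p.2) = ⊤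

/-- `1 → U → S → T → 1`, with comorphisms `p : 𝒪(T) → 𝒪(S)` and `q : 𝒪(S) → 𝒪(U)`, is an exact
sequence of algebraic groups: `S → T` is surjective (`p` is injective), `U → S` is a closed
embedding (`q` is surjective), and `U` is the fibre of `S → T` over the identity, that is, the
ideal of `U` is generated by the functions on `T` that vanish at the identity. -/
structure IsExact {B A : Type v} {C : Type w} [CommRing B] [HopfAlgebra ℂ B] [CommRing A] [HopfAlgebra ℂ A]
    [CommRing C] [HopfAlgebra ℂ C] (p : B →ₐc[ℂ] A) (q : A →ₐc[ℂ] C) : Prop where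
  injective : Function.Injective p
  surjective : Function.Surjective q
  ker_eq : RingHom.ker (q : A →ₐ[ℂ] C) =
    (RingHom.ker (Bialgebra.counitAlgHom ℂ B)).map (p : B →ₐ[ℂ] A)

section

variable {G : Type u} [Group G] {B : Type v} [CommRing B] [HopfAlgebra ℂ B]

/-- A solvable representation relative to `ρ : G → T(ℂ)`: a homomorphism `φ : G → S(ℂ)` with
Zariski dense image into a linear algebraic group `S`, together with a surjection `S → T` under
which `φ` lies over `ρ` and whose kernel `U` is unipotent. -/
structure SolvRep (ρ : G →* Points B ℂ) where
  /-- the coordinate ring of `S` -/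
  A : Type v
  [commRing : CommRing A]
  [hopfAlgebra : HopfAlgebra ℂ A]
  finiteType : Algebra.FiniteType ℂ A
  /-- the homomorphism `G → S(ℂ)` -/
  φ : G →* Points A ℂ
  dense : IsZariskiDense φ
  /-- the comorphism of `S → T` -/
  p : B →ₐc[ℂ] A
  comap_φ : ∀ g, Points.comap p (φ g) = ρ g
  /-- the kernel `U` is unipotent; its coordinate ring is a finitely generated `ℂ`-algebra, so it may
  be taken in `Type` without loss of generality -/
  exact_unipotent : ∃ (C : Type) (_ : CommRing C) (_ : HopfAlgebra ℂ C) (q : A →ₐc[ℂ] C),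
    IsExact p q ∧ IsUnipotent C

attribute [instance] SolvRep.commRing SolvRep.hopfAlgebra

/-- A homomorphism `S → S'` of solvable representations relative to `ρ`, given by its comorphism:
it commutes with the homomorphisms from `G` and with the projections to `T`. -/
structure SolvRep.Hom {ρ : G →* Points B ℂ} (S S' : SolvRep ρ) where
  /-- the comorphism -/
  f : S'.A →ₐc[ℂ] S.A
  comap_φ : ∀ g, Points.comap f (S.φ g) = S'.φ g
  comp_p : ∀ b, f (S'.p b) = S.p b

/-- The solvable completion `𝒮_ρ(G)` of `G` relative to `ρ`: the inverse limit of all solvable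
representations relative to `ρ`, as a group functor on commutative `ℂ`-algebras `R`.  An
`R`-point is a family of `R`-points of all the groups `S` that is compatible with all the
homomorphisms of solvable representations. -/
def Completion (ρ : G →* Points B ℂ) (R : Type w) [CommRing R] [Algebra ℂ R] :
    Subgroup (∀ S : SolvRep ρ, Points S.A R) where
  carrier := {s | ∀ (S S' : SolvRep ρ) (h : S.Hom S'), Points.comap h.f (s S) = s S'}
  one_mem' S S' h := by simp
  mul_mem' {s t} hs ht S S' h := by simp [hs S S' h, ht S S' h]
  inv_mem' {s} hs S S' h := by simp [hs S S' h]

theorem Points.map_comap {A A' : Type v} [CommRing A] [HopfAlgebra ℂ A] [CommRing A']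
    [HopfAlgebra ℂ A'] {R R' : Type w} [CommRing R] [Algebra ℂ R] [CommRing R'] [Algebra ℂ R']
    (k : R →ₐ[ℂ] R') (f : A' →ₐc[ℂ] A) (x : Points A R) :
    Points.comap f (Points.map k x) = Points.map k (Points.comap f x) := rfl

/-- The functoriality `𝒮_ρ(G)(R) → 𝒮_ρ(G)(R')` of the solvable completion. -/
def Completion.map (ρ : G →* Points B ℂ) {R R' : Type w} [CommRing R] [Algebra ℂ R]
    [CommRing R'] [Algebra ℂ R'] (k : R →ₐ[ℂ] R') : Completion ρ R →* Completion ρ R' where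
  toFun s := ⟨fun S => Points.map k (s.1 S), fun S S' h => by
    rw [Points.map_comap, s.2 S S' h]⟩
  map_one' := by ext S : 2; simp
  map_mul' s t := by ext S : 2; simp

end

end SolvComp

end

/-! Coordinates of `G` modulo torsion together with `ρ` make `𝔾ₐᵐ × T` a solvable representation. It
is initial among all of them, so the inverse limit is its group of points (`completionEquiv`).

Everything is tested on functions on `G`: if `G` is dense in `S`, then `𝒪(S)` embeds in the
functions on `G`. A function coming from an affine group has translates spanning a finite
dimensional space, which over `ℂ` splits into generalized weight spaces of the commuting
translations. A generalized weight vector is a polynomial in the coordinates times a character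
(`Coordinates.eq_aeval_mul_of_mem_weightSpace`). So every `S` receives a homomorphism from `𝔾ₐᵐ ×
D`, where `D` is the diagonalizable group, in general not algebraic, whose characters are all
characters of `G`.

Unipotence of `U` leaves only the characters of `T`. The kernel of `D → T` has character group
`CharQuotient ρ`; it maps to `U`, and such a homomorphism is trivial (`IsUnipotent.bialgHom_eq`).
Hence functions on `S` pull back to functions invariant under this kernel, which are the regular
functions on `𝔾ₐᵐ × T` (`Coordinates.exists_prodHom_eval_eq`). Density of `G` in `𝔾ₐᵐ × T` is
`Coordinates.isZariskiDense_prodHom`: distinct characters have independent weight spaces, and a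
polynomial vanishing on `ℤᵐ` is zero. -/

noncomputable section

namespace SolvComp

open scoped TensorProduct Coalgebra

/-! ### The vector group `𝔾ₐᵐ`. -/

section Symmetric

variable (R : Type*) [CommRing R] (M : Type*) [AddCommGroup M] [Module R M]

instance : HopfAlgebra R (SymmetricAlgebra R M) :=
  .ofAlgHom (SymmetricAlgebra.lift (-SymmetricAlgebra.ι R M))
    (SymmetricAlgebra.algHom_ext (LinearMap.ext fun x => by
      change Algebra.TensorProduct.lift _ _ (fun _ _ => Commute.all _ _)
          (Coalgebra.comul (SymmetricAlgebra.ι R M x)) =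
        algebraMap R _ (Coalgebra.counit (SymmetricAlgebra.ι R M x))
      rw [SymmetricAlgebra.comul_ι, SymmetricAlgebra.counit_ι, map_add,
        Algebra.TensorProduct.lift_tmul, Algebra.TensorProduct.lift_tmul]
      simp))
    (SymmetricAlgebra.algHom_ext (LinearMap.ext fun x => by
      change Algebra.TensorProduct.lift _ _ (fun _ _ => Commute.all _ _)
          (Coalgebra.comul (SymmetricAlgebra.ι R M x)) =
        algebraMap R _ (Coalgebra.counit (SymmetricAlgebra.ι R M x))
      rw [SymmetricAlgebra.comul_ι, SymmetricAlgebra.counit_ι, map_add,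
        Algebra.TensorProduct.lift_tmul, Algebra.TensorProduct.lift_tmul]
      simp))

end Symmetric

/-- The coordinate ring of the vector group `𝔾ₐᵐ`. -/
abbrev VecCoord (m : ℕ) : Type := SymmetricAlgebra ℂ (Fin m → ℂ)

namespace VecCoord

variable {m : ℕ} {R : Type w} [CommRing R] [Algebra ℂ R]

/-- The coordinate functions on `𝔾ₐᵐ`. -/
def X (i : Fin m) : VecCoord m := SymmetricAlgebra.ι ℂ _ (Pi.single i 1)

/-- Evaluation of functions on `𝔾ₐᵐ` at a point. -/
def aeval (c : Fin m → R) : VecCoord m →ₐ[ℂ] R :=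
  SymmetricAlgebra.lift (Fintype.linearCombination ℂ c)

@[simp]
theorem aeval_X (c : Fin m → R) (i : Fin m) : aeval c (X i) = c i := by
  simp [aeval, X]

theorem algHom_ext {f g : VecCoord m →ₐ[ℂ] R} (h : ∀ i, f (X i) = g (X i)) : f = g := by
  ext i
  simpa [X] using h i

@[simp]
theorem comul_X (i : Fin m) :
    Coalgebra.comul (R := ℂ) (X i) = X i ⊗ₜ[ℂ] 1 + 1 ⊗ₜ[ℂ] X i :=
  SymmetricAlgebra.comul_ι ..

@[simp]
theorem counit_X (i : Fin m) : Coalgebra.counit (R := ℂ) (X i) = 0 :=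
  SymmetricAlgebra.counit_ι ..

variable (m) in
/-- The coordinate ring of `𝔾ₐᵐ` is a polynomial ring. -/
def equivMvPolynomial : VecCoord m ≃ₐ[ℂ] MvPolynomial (Fin m) ℂ :=
  AlgEquiv.ofAlgHom (aeval MvPolynomial.X) (MvPolynomial.aeval X)
    (by ext; simp) (algHom_ext (by simp))

theorem aeval_eq (c : Fin m → R) (P : VecCoord m) :
    aeval c P = MvPolynomial.aeval c (equivMvPolynomial m P) := by
  have : aeval c = (MvPolynomial.aeval c).comp (equivMvPolynomial m : _ →ₐ[ℂ] _) :=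
    algHom_ext (by simp [equivMvPolynomial])
  exact congr($this P)

theorem adjoin_X : Algebra.adjoin ℂ (Set.range (X (m := m))) = ⊤ := by
  have h : Set.range X = (equivMvPolynomial m).symm.toAlgHom '' Set.range MvPolynomial.X := by
    rw [← Set.range_comp]
    congr 1
    ext i
    simp [equivMvPolynomial]
  rw [h, ← AlgHom.map_adjoin, MvPolynomial.adjoin_range_X, Algebra.map_top]
  exact (AlgHom.range_eq_top _).2 (equivMvPolynomial m).symm.surjective

instance : Algebra.FiniteType ℂ (VecCoord m) := .equiv inferInstance (equivMvPolynomial m).symm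

/-- A polynomial function that vanishes on `ℤᵐ` is zero. -/
theorem eq_zero_of_aeval_int {P : VecCoord m} (h : ∀ n : Fin m → ℤ, aeval (fun i => (n i : ℂ)) P = 0) :
    P = 0 := by
  rw [← map_eq_zero_iff _ (equivMvPolynomial m).injective]
  refine MvPolynomial.funext_set (fun _ => Set.range ((↑) : ℤ → ℂ))
    (fun _ => Set.infinite_range_of_injective Int.cast_injective) fun c hc => ?_
  choose n hn using fun i => hc i trivial
  obtain rfl : (fun i => (n i : ℂ)) = c := funext hn
  simpa [aeval_eq] using h n

/-- `𝔾ₐᵐ` is unipotent. -/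
theorem isUnipotent : IsUnipotent (VecCoord m) := by
  -- The identity matrix with the coordinates placed in row `0`; multiplying such matrices adds
  -- these rows.
  let M : Matrix (Fin (m + 1)) (Fin (m + 1)) (VecCoord m) :=
    Matrix.of fun i j => if i = j then 1 else if i = 0 then Fin.cases 0 X j else 0
  have M0 (j : Fin m) : M 0 j.succ = X j := by simp [M, (Fin.succ_ne_zero j).symm]
  have Md (i) : M i i = 1 := by simp [M]
  have Ms (i : Fin m) (j) (h : i.succ ≠ j) : M i.succ j = 0 := by simp [M, h]
  refine ⟨m + 1, M, Md, fun i j h => ?_, fun i j => ?_, fun i j => ?_, ?_⟩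
  · obtain rfl | ⟨i, rfl⟩ := i.eq_zero_or_eq_succ
    · exact absurd h (Fin.not_lt_zero j)
    · exact Ms _ _ h.ne'
  · obtain rfl | ⟨i, rfl⟩ := i.eq_zero_or_eq_succ
    · rw [Fin.sum_univ_succ, Md]
      obtain rfl | ⟨j, rfl⟩ := j.eq_zero_or_eq_succ
      · rw [Finset.sum_eq_zero fun k _ => by rw [Ms k 0 (Fin.succ_ne_zero k), TensorProduct.tmul_zero]]
        simp [Md, Algebra.TensorProduct.one_def]
      · rw [Finset.sum_eq_single j]
        · rw [M0, Md, comul_X, add_comm]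
        · intro k _ hk
          rw [Ms k _ (by simpa using hk), TensorProduct.tmul_zero]
        · simp
    · rw [Finset.sum_eq_single i.succ]
      · rw [Md]
        by_cases h : i.succ = j
        · subst h; simp [Md, Algebra.TensorProduct.one_def]
        · simp [Ms _ _ h]
      · intro k _ hk
        rw [Ms _ _ hk.symm, TensorProduct.zero_tmul]
      · simp
  · obtain rfl | ⟨i, rfl⟩ := i.eq_zero_or_eq_succ
    · obtain rfl | ⟨j, rfl⟩ := j.eq_zero_or_eq_succ
      · simp [Md]
      · simp [M0, (Fin.succ_ne_zero j).symm]
    · by_cases h : i.succ = j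
      · subst h; simp [Md]
      · simp [Ms _ _ h, h]
  · rw [eq_top_iff, ← adjoin_X]
    refine Algebra.adjoin_mono ?_
    rintro _ ⟨i, rfl⟩
    exact ⟨(0, i.succ), M0 i⟩

/-- The `R`-points of `𝔾ₐᵐ` are `Rᵐ`. -/
def pointsEquiv (m : ℕ) (R : Type w) [CommRing R] [Algebra ℂ R] :
    Points (VecCoord m) R ≃* Multiplicative (Fin m → R) where
  toFun x := .ofAdd fun i => x.eval (X i)
  invFun c := Points.mk (aeval c.toAdd)
  left_inv x := by
    refine Points.ext fun a => ?_
    have h : aeval (fun i => x.eval (X i)) = x.eval := algHom_ext (by simp)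
    exact congr($h a)
  right_inv c := by
    refine Multiplicative.toAdd.injective ?_
    ext i
    simp
  map_mul' x y := by
    refine Multiplicative.toAdd.injective ?_
    ext i
    simp [Points.eval_mul]

end VecCoord

/-! ### Products of affine groups. -/

namespace Points

variable {A : Type u} [CommRing A] [HopfAlgebra ℂ A] {B : Type v} [CommRing B] [HopfAlgebra ℂ B]

variable (A B) in
/-- The comorphism of the first projection `S × T → S`. -/
def inl : A →ₐc[ℂ] A ⊗[ℂ] B :=
  .ofAlgHom Algebra.TensorProduct.includeLeft (by ext; simp) (by
    ext a
    simp [← (ℛ ℂ a).eq, TensorProduct.sum_tmul, Algebra.TensorProduct.one_def])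

variable (A B) in
/-- The comorphism of the second projection `S × T → T`. -/
def inr : B →ₐc[ℂ] A ⊗[ℂ] B :=
  .ofAlgHom Algebra.TensorProduct.includeRight (by ext; simp) (by
    ext a
    simp [← (ℛ ℂ a).eq, TensorProduct.tmul_sum, Algebra.TensorProduct.one_def])

@[simp]
theorem inr_apply (b : B) : inr A B b = 1 ⊗ₜ b := rfl

variable (A B) in
/-- The `R`-points of a product of affine groups. -/
def prodEquiv (R : Type w) [CommRing R] [Algebra ℂ R] :
    Points (A ⊗[ℂ] B) R ≃* Points A R × Points B R where
  toFun x := (mk (x.eval.comp (inl A B : A →ₐ[ℂ] A ⊗[ℂ] B)),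
    mk (x.eval.comp (inr A B : B →ₐ[ℂ] A ⊗[ℂ] B)))
  invFun x := mk (Algebra.TensorProduct.productMap x.1.eval x.2.eval)
  left_inv x := WithConv.ofConv_injective (by
    refine Algebra.TensorProduct.ext ?_ ?_
    · exact Algebra.TensorProduct.productMap_left ..
    · exact Algebra.TensorProduct.productMap_right ..)
  right_inv x := Prod.ext
    (WithConv.ofConv_injective (Algebra.TensorProduct.productMap_left ..))
    (WithConv.ofConv_injective (Algebra.TensorProduct.productMap_right ..))
  map_mul' x y := Prod.ext
    (WithConv.ofConv_injective (AlgHom.convMul_comp_bialgHom_distrib x y (inl A B)))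
    (WithConv.ofConv_injective (AlgHom.convMul_comp_bialgHom_distrib x y (inr A B)))

@[simp]
theorem prodEquiv_symm_eval_tmul {R : Type w} [CommRing R] [Algebra ℂ R]
    (x : Points A R × Points B R) (a : A) (b : B) :
    ((prodEquiv A B R).symm x).eval (a ⊗ₜ b) = x.1.eval a * x.2.eval b :=
  Algebra.TensorProduct.productMap_apply_tmul ..

theorem eval_mul_apply {R : Type w} [CommRing R] [Algebra ℂ R] (x y : Points A R) (a : A) :
    (x * y).eval a = Algebra.TensorProduct.productMap x.eval y.eval (Coalgebra.comul a) := by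
  rw [eval_mul, Algebra.TensorProduct.productMap_eq_comp_map]
  rfl

theorem eval_one_apply {R : Type w} [CommRing R] [Algebra ℂ R] (a : A) :
    (1 : Points A R).eval a = algebraMap ℂ R (Coalgebra.counit a) := rfl

end Points

/-! ### Detecting identities of regular functions on a dense image of `G`. -/

section Dense

variable {G : Type*} [Group G] {A : Type u} [CommRing A] [HopfAlgebra ℂ A]
  {E : Type v} [CommRing E] [HopfAlgebra ℂ E]

open Algebra.TensorProduct (productMap)

theorem IsZariskiDense.eq_of_eval_eq {φ : G →* Points A ℂ} (hφ : IsZariskiDense φ) {a b : A}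
    (h : ∀ g, (φ g).eval a = (φ g).eval b) : a = b :=
  sub_eq_zero.1 (hφ _ fun g => by rw [map_sub, h, sub_self])

/-- Density of the image of `G × G` in `S × S`. Write `z = ∑ aₖ ⊗ bₖ` with a basis `bₖ`. For fixed
`g`, density in the second variable gives `∑ aₖ(g) bₖ = 0`, so every `aₖ(g)` is zero, and density in
the first variable gives `aₖ = 0`. -/
theorem IsZariskiDense.tensor_eq_zero {φ : G →* Points A ℂ} (hφ : IsZariskiDense φ) {z : A ⊗[ℂ] A}
    (h : ∀ g g', productMap (φ g).eval (φ g').eval z = 0) : z = 0 := by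
  classical
  let b := Module.Basis.ofVectorSpace ℂ A
  let e := TensorProduct.equivFinsuppOfBasisRight (M := A) b
  have hz : z = (e z).sum fun k a => a ⊗ₜ b k := by
    rw [← TensorProduct.equivFinsuppOfBasisRight_symm_apply, LinearEquiv.symm_apply_apply]
  rw [← e.map_eq_zero_iff]
  ext k
  refine hφ _ fun g => ?_
  have h0 : (e z).sum (fun k a => (φ g).eval a • b k) = 0 := by
    refine hφ _ fun g' => ?_
    rw [← h g g']
    conv_rhs => rw [hz]
    simp [Finsupp.sum, map_sum]
  have := linearIndependent_iff'.1 b.linearIndependent _ _ h0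
  by_cases hk : k ∈ (e z).support
  · exact this k hk
  · rw [Finsupp.notMem_support_iff.1 hk, map_zero]

/-- An algebra homomorphism that is compatible with homomorphisms from `G` to the groups of points,
the second one having dense image, is a homomorphism of bialgebras. -/
def IsZariskiDense.bialgHom {ψ : G →* Points E ℂ} (hψ : IsZariskiDense ψ) (φ : G →* Points A ℂ)
    (f : A →ₐ[ℂ] E) (hf : ∀ g a, (ψ g).eval (f a) = (φ g).eval a) : A →ₐc[ℂ] E :=
  .ofAlgHom f
    (by
      ext a
      have := hf 1 a
      rwa [map_one, map_one] at this)
    (by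
      ext a
      -- At a pair `(g, g')`, compatibility with comultiplication becomes multiplicativity of `φ`
      -- and `ψ`.
      refine sub_eq_zero.1 (hψ.tensor_eq_zero fun g g' => ?_)
      rw [map_sub, sub_eq_zero]
      have h1 : productMap (ψ g).eval (ψ g').eval (Coalgebra.comul (f a)) =
          productMap (φ g).eval (φ g').eval (Coalgebra.comul a) := by
        rw [← Points.eval_mul_apply, ← Points.eval_mul_apply, ← map_mul, ← map_mul, hf]
      refine .trans ?_ h1.symm
      have h2 : (productMap (ψ g).eval (ψ g').eval).comp (Algebra.TensorProduct.map f f) =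
          productMap (φ g).eval (φ g').eval := by
        ext a <;> simp [hf]
      exact congr($h2 (Coalgebra.comul a)))

end Dense

/-! ### Abelian groups modulo torsion. -/

/-- Coordinates on an abelian group modulo torsion. -/
structure Coordinates (G : Type*) [CommGroup G] (m : ℕ) where
  /-- the coordinates of an element -/
  x : G → Fin m → ℤ
  x_mul : ∀ g h, x (g * h) = x g + x h
  /-- the basis elements -/
  e : Fin m → G
  x_prod : ∀ n : Fin m → ℤ, x (∏ i, e i ^ n i) = n
  torsion : ∀ g, IsOfFinOrder (g * (∏ i, e i ^ x g i)⁻¹)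

theorem Coordinates.nonempty (G : Type*) [CommGroup G] [Group.FG G] :
    Nonempty (Coordinates G (Module.finrank ℤ (Additive G))) := by
  let M := Additive G
  let T := Submodule.torsion ℤ M
  have : Module.Finite ℤ M := Module.Finite.iff_addGroup_fg.2 inferInstance
  have : Module.Free ℤ (M ⧸ T) := inferInstance
  have hr : Module.finrank ℤ (M ⧸ T) = Module.finrank ℤ M :=
    finrank_quotient_eq_of_le_torsion le_rfl
  let b : Module.Basis (Fin (Module.finrank ℤ M)) ℤ (M ⧸ T) := Module.finBasisOfFinrankEq ℤ _ hr
  choose e he using fun i => T.mkQ_surjective (b i)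
  have hx (n : Fin (Module.finrank ℤ M) → ℤ) : b.equivFun (T.mkQ (∑ i, n i • e i)) = n := by
    rw [map_sum]
    simp_rw [map_smul, he]
    rw [← b.equivFun_symm_apply, LinearEquiv.apply_symm_apply]
  refine ⟨⟨fun g => b.equivFun (T.mkQ (Additive.ofMul g)), fun g h => ?_, fun i => (e i).toMul,
    hx, fun g => ?_⟩⟩
  · rw [ofMul_mul, map_add, map_add]
  · have h : Additive.ofMul g - ∑ i, b.equivFun (T.mkQ (Additive.ofMul g)) i • e i ∈ T := by
      rw [← Submodule.Quotient.mk_eq_zero, ← Submodule.mkQ_apply, map_sub, sub_eq_zero]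
      apply b.equivFun.injective
      rw [hx]
    obtain ⟨a, ha⟩ := (Submodule.mem_torsion_iff _).1 h
    rw [← div_eq_mul_inv, isOfFinOrder_iff_zpow_eq_one]
    exact ⟨a, nonZeroDivisors.coe_ne_zero a, ha⟩

/-! ### Unipotent representations are polynomial in the coordinates. -/

section Unipotent

variable {K : Type*} [CommRing K] [Algebra ℂ K]

open Polynomial in
/-- The powers of a unipotent element depend polynomially on the exponent. -/
theorem exists_polynomial_zpow (u : Kˣ) (hu : IsNilpotent ((u : K) - 1)) :
    ∃ q : K[X], ∀ n : ℤ, ((u ^ n : Kˣ) : K) = q.eval (n : K) := by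
  obtain ⟨d, hd⟩ := hu
  set N : K := u - 1 with hN
  -- The binomial series of `(1 + N) ^ n`. The term `k = d` vanishes; it is kept so that the term `k
  -- = 0` can be split off even when `d = 0`.
  let F (n : ℤ) : K := ∑ k ∈ Finset.range (d + 1), N ^ k * (Ring.choose n k : ℤ)
  have hF (n : ℤ) : F (n + 1) = F n * u := by
    have hu : (u : K) = 1 + N := by rw [hN]; ring
    have h1 : F n * N = ∑ k ∈ Finset.range d, N ^ (k + 1) * (Ring.choose n k : ℤ) := by
      rw [Finset.sum_mul, Finset.sum_range_succ, hd, zero_mul, zero_mul, add_zero]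
      exact Finset.sum_congr rfl fun k _ => by ring
    rw [hu, mul_add, mul_one, h1]
    simp only [F]
    rw [Finset.sum_range_succ', Finset.sum_range_succ' _ d, add_right_comm,
      ← Finset.sum_add_distrib]
    congr 1
    · refine Finset.sum_congr rfl fun k _ => ?_
      rw [Ring.choose_succ_succ]
      push_cast
      ring
    · simp
  have hF0 : F 0 = 1 := by
    simp only [F]
    rw [Finset.sum_range_succ', Finset.sum_eq_zero fun k _ => by
      rw [Ring.choose_zero_succ, Int.cast_zero, mul_zero]]
    simp
  -- The binomial coefficient is the falling factorial divided by `k!`, which is invertible in a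
  -- `ℂ`-algebra.
  refine ⟨∑ k ∈ Finset.range (d + 1),
    C (N ^ k * algebraMap ℂ K (k.factorial : ℂ)⁻¹) * (descPochhammer ℤ k).map (Int.castRingHom K),
    fun n => ?_⟩
  have hq : F n = ∑ k ∈ Finset.range (d + 1), N ^ k * algebraMap ℂ K (k.factorial : ℂ)⁻¹ *
      ((descPochhammer ℤ k).map (Int.castRingHom K)).eval (n : K) := by
    refine Finset.sum_congr rfl fun k _ => ?_
    have h1 : (descPochhammer ℤ k).eval n = k.factorial * Ring.choose n k := by
      have := Ring.descPochhammer_eq_factorial_smul_choose n k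
      rwa [← Polynomial.eval_eq_smeval, nsmul_eq_mul] at this
    have h2 := Polynomial.eval_intCast_map (Int.castRingHom K) (descPochhammer ℤ k) n
    rw [h2, Int.cast_id, h1]
    have h3 : algebraMap ℂ K (k.factorial : ℂ)⁻¹ * (k.factorial : K) = 1 := by
      rw [← map_natCast (algebraMap ℂ K), ← map_mul,
        inv_mul_cancel₀ (by exact_mod_cast k.factorial_ne_zero), map_one]
    rw [eq_intCast, Int.cast_mul, Int.cast_natCast, mul_assoc, ← mul_assoc _ (k.factorial : K), h3,
      one_mul]
  rw [Polynomial.eval_finsetSum]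
  simp only [Polynomial.eval_mul, Polynomial.eval_C]
  rw [← hq]
  clear hq
  induction n using Int.induction_on with
  | zero => simp [hF0]
  | succ n ih => rw [hF, ← ih, zpow_add_one, Units.val_mul]
  | pred n ih =>
    rw [← Units.mul_left_inj u, ← hF, sub_add_cancel, ← ih, ← Units.val_mul, ← zpow_add_one,
      sub_add_cancel]

/-- In `0 = t ^ k - 1 = (∑ t ^ i) (t - 1)` the sum is `k` plus a nilpotent element, hence a unit.
This kills the torsion of `G` in unipotent representations. -/
theorem eq_one_of_pow_eq_one_of_isNilpotent {t : K} (ht : IsNilpotent (t - 1)) {k : ℕ} (hk : 0 < k)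
    (h : t ^ k = 1) : t = 1 := by
  have h1 : (∑ i ∈ Finset.range k, t ^ i) * (t - 1) = 0 := by rw [geom_sum_mul, h, sub_self]
  have h2 : IsNilpotent (∑ i ∈ Finset.range k, (t ^ i - 1)) :=
    isNilpotent_sum fun i _ => by
      rw [← mul_geom_sum]
      exact Commute.isNilpotent_mul_right (Commute.all _ _) ht
  have h3 : IsUnit (k : K) := by
    rw [← map_natCast (algebraMap ℂ K)]
    exact (IsUnit.mk0 (k : ℂ) (by exact_mod_cast hk.ne')).map _
  have h4 : IsUnit (∑ i ∈ Finset.range k, t ^ i) := by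
    have := h2.isUnit_add_right_of_commute h3 (Commute.all _ _)
    simpa using this
  exact sub_eq_zero.1 (h4.mul_right_eq_zero.1 h1)

variable {G : Type*} [CommGroup G] {m : ℕ} (c : Coordinates G m)

/-- The coordinates as complex numbers. -/
def Coordinates.val (g : G) (i : Fin m) : ℂ := c.x g i

/-- The matrix coefficients of a unipotent representation are polynomials in the coordinates. -/
theorem Coordinates.exists_of_unipotent (σ : G →* K) (hσ : ∀ g, IsNilpotent (σ g - 1))
    (l : K →ₗ[ℂ] ℂ) : ∃ P : VecCoord m, ∀ g, l (σ g) = VecCoord.aeval (c.val g) P := by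
  have hQ : ∃ Q : MvPolynomial (Fin m) K,
      ∀ g, σ g = MvPolynomial.eval (fun i => (c.x g i : K)) Q := by
    choose q hq using fun i => exists_polynomial_zpow (σ.toHomUnits (c.e i)) (hσ (c.e i))
    refine ⟨∏ i, Polynomial.aeval (MvPolynomial.X i) (q i), fun g => ?_⟩
    obtain ⟨k, hk, h⟩ := isOfFinOrder_iff_pow_eq_one.1 (c.torsion g)
    have ht := eq_one_of_pow_eq_one_of_isNilpotent (hσ _) hk (by rw [← map_pow, h, map_one])
    have hg : σ g = σ (∏ i, c.e i ^ c.x g i) := by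
      conv_lhs => rw [← inv_mul_cancel_right g (∏ i, c.e i ^ c.x g i), map_mul, ht, one_mul]
    rw [hg, map_prod, map_prod]
    refine Finset.prod_congr rfl fun i _ => ?_
    have h1 : σ (c.e i ^ c.x g i) = ((σ.toHomUnits (c.e i) ^ c.x g i : Kˣ) : K) := by
      rw [← map_zpow]; rfl
    rw [h1, hq, Polynomial.aeval_def, Polynomial.hom_eval₂]
    simp [Polynomial.eval_eq_sum, Polynomial.eval₂_eq_sum]
  obtain ⟨Q, hQ⟩ := hQ
  -- The coordinates are complex scalars, so `l` can be applied coefficientwise to `Q`.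
  refine ⟨Q.support.sum fun d => l (Q.coeff d) • ∏ i, VecCoord.X i ^ d i, fun g => ?_⟩
  rw [hQ, MvPolynomial.eval_eq', map_sum, map_sum]
  refine Finset.sum_congr rfl fun d _ => ?_
  have : ∏ i, (c.x g i : K) ^ d i = algebraMap ℂ K (∏ i, c.val g i ^ d i) := by
    simp [map_prod, Coordinates.val]
  rw [this, mul_comm, ← Algebra.smul_def]
  simp [map_prod, mul_comm]

end Unipotent

/-! ### Generalized weight spaces of functions on `G`. -/

section Functions

variable {G : Type*} [CommGroup G]

variable (G) in
/-- The translation action of `G` on the functions on `G`. -/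
def shift : G →* Module.End ℂ (G → ℂ) where
  toFun g := LinearMap.funLeft ℂ ℂ (· * g)
  map_one' := by ext; simp
  map_mul' g h := by ext; simp [LinearMap.funLeft_apply, mul_assoc]

@[simp]
theorem shift_apply (g : G) (f : G → ℂ) (x : G) : shift G g f x = f (x * g) := rfl

theorem shift_commute (g h : G) : Commute (shift G g) (shift G h) := (Commute.all g h).map _

/-- The functions on `G` on which each translation by `g` acts with the only generalized eigenvalue
`χ g`. -/
def weightSpace (χ : G → ℂ) : Submodule ℂ (G → ℂ) :=
  ⨅ g, (shift G g).maxGenEigenspace (χ g)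

theorem mem_weightSpace {χ : G → ℂ} {f : G → ℂ} :
    f ∈ weightSpace χ ↔ ∀ g, ∃ k : ℕ, ((shift G g - χ g • 1) ^ k) f = 0 := by
  simp [weightSpace, Submodule.mem_iInf, Module.End.mem_maxGenEigenspace]

theorem iSupIndep_weightSpace : iSupIndep (weightSpace (G := G)) :=
  Module.End.independent_iInf_maxGenEigenspace_of_forall_mapsTo (shift G) fun g h _ =>
    Module.End.mapsTo_maxGenEigenspace_of_comm (shift_commute h g) _

/-- With `τ` the translation, `(τ - ab)(f f') = (τ - a)f · τf' + af · (τ - b)f'`. Each term lowers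
`k` or `l` by one, since `τ` commutes with `τ - b`, and induction on `k + l` applies; when `k` or
`l` is already `0`, that factor is the zero function. -/
theorem pow_shift_sub_mul_eq_zero (g : G) (a b : ℂ) (n : ℕ) :
    ∀ (k l : ℕ) (f f' : G → ℂ), k + l = n → ((shift G g - a • 1) ^ k) f = 0 →
      ((shift G g - b • 1) ^ l) f' = 0 → ((shift G g - (a * b) • 1) ^ n) (f * f') = 0 := by
  induction n with
  | zero =>
    intro k l f f' h hf _
    obtain rfl : k = 0 := by omega
    rw [pow_zero, Module.End.one_apply] at hf
    simp [hf]
  | succ n ih =>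
    intro k l f f' h hf hf'
    have key : (shift G g - (a * b) • 1) (f * f') =
        ((shift G g - a • 1) f) * shift G g f' + (a • f) * ((shift G g - b • 1) f') := by
      ext x
      simp
      ring
    rw [pow_succ, Module.End.mul_apply, key, map_add]
    have h1 : ((shift G g - (a * b) • 1) ^ n) (((shift G g - a • 1) f) * shift G g f') = 0 := by
      rcases k with _ | k
      · rw [pow_zero, Module.End.one_apply] at hf
        simp [hf]
      · refine ih k l _ _ (by omega) ?_ ?_
        · rwa [← Module.End.mul_apply, ← pow_succ]
        · have hc : Commute ((shift G g - b • 1) ^ l) (shift G g) :=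
            (((Commute.refl _).sub_left ((Commute.one_left _).smul_left _))).pow_left l
          rw [← Module.End.mul_apply, hc.eq, Module.End.mul_apply, hf', map_zero]
    have h2 : ((shift G g - (a * b) • 1) ^ n) ((a • f) * ((shift G g - b • 1) f')) = 0 := by
      rcases l with _ | l
      · rw [pow_zero, Module.End.one_apply] at hf'
        simp [hf']
      · refine ih k l _ _ (by omega) ?_ ?_
        · rw [map_smul, hf, smul_zero]
        · rwa [← Module.End.mul_apply, ← pow_succ]
    rw [h1, h2, add_zero]

theorem mul_mem_weightSpace {χ χ' : G → ℂ} {f f' : G → ℂ} (hf : f ∈ weightSpace χ)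
    (hf' : f' ∈ weightSpace χ') : f * f' ∈ weightSpace (χ * χ') := by
  rw [mem_weightSpace] at *
  intro g
  obtain ⟨k, hk⟩ := hf g
  obtain ⟨l, hl⟩ := hf' g
  exact ⟨k + l, pow_shift_sub_mul_eq_zero g _ _ _ k l f f' rfl hk hl⟩

theorem character_mem_weightSpace (χ : G →* ℂ) : ⇑χ ∈ weightSpace χ :=
  mem_weightSpace.2 fun g => ⟨1, by ext x; simp [mul_comm]⟩

variable (G) in
/-- The algebra of functions on which `G` acts unipotently. -/
def unipotentFunctions : Subalgebra ℂ (G → ℂ) where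
  __ := weightSpace (G := G) 1
  mul_mem' hf hf' := by simpa using mul_mem_weightSpace hf hf'
  algebraMap_mem' a := mem_weightSpace.2 fun g => ⟨1, by ext x; simp⟩

variable {m : ℕ} (c : Coordinates G m)

/-- Each coordinate is additive, so it is killed by the square of every `τ - 1`; the functions of
weight `1` form an algebra. -/
theorem Coordinates.aeval_mem_weightSpace (P : VecCoord m) :
    (fun g => VecCoord.aeval (c.val g) P) ∈ weightSpace (1 : G → ℂ) := by
  have hx (i : Fin m) : (fun g => c.val g i) ∈ unipotentFunctions G := by
    refine mem_weightSpace.2 fun g => ⟨2, ?_⟩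
    ext x
    simp [pow_two, Coordinates.val, c.x_mul]
  let F := VecCoord.aeval (m := m) (R := unipotentFunctions G) fun i => ⟨_, hx i⟩
  have hF (g : G) : VecCoord.aeval (c.val g) =
      (Pi.evalAlgHom ℂ _ g).comp ((unipotentFunctions G).val.comp F) :=
    VecCoord.algHom_ext (by simp [F])
  simp_rw [hF]
  exact (F P).2

/-- Generalized weight vectors are products of polynomials in the coordinates and characters. -/
theorem Coordinates.eq_aeval_mul_of_mem_weightSpace {χ : G → ℂ} {f : G → ℂ}
    (hf : f ∈ weightSpace χ) (hf0 : f ≠ 0) : ∃ (P : VecCoord m) (ψ : G →* ℂˣ),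
      ∀ g, f g = VecCoord.aeval (c.val g) P * ψ g := by
  let L : MonoidAlgebra ℂ G →ₐ[ℂ] Module.End ℂ (G → ℂ) := MonoidAlgebra.lift ℂ _ G (shift G)
  -- The annihilator of `f`. In the commutative ring `K = ℂ[G] / I` the class of `g` is `χ g` plus a
  -- nilpotent, and `f g` is recovered by the functional `l`, "act on `f` and evaluate at `1`".
  let I : Ideal (MonoidAlgebra ℂ G) :=
    { carrier := {k | L k f = 0}
      add_mem' := fun {a b} ha hb => by
        simp only [Set.mem_ofPred_eq] at *
        rw [map_add, LinearMap.add_apply, ha, hb, add_zero]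
      zero_mem' := by simp
      smul_mem' := fun a b hb => by
        simp only [Set.mem_ofPred_eq] at *
        rw [smul_eq_mul, map_mul, Module.End.mul_apply, hb, map_zero] }
  let K := MonoidAlgebra ℂ G ⧸ I
  let σ : G →* K := (Ideal.Quotient.mk I : _ →* K).comp (MonoidAlgebra.of ℂ G)
  have hLof (g : G) : L (MonoidAlgebra.of ℂ G g) = shift G g := MonoidAlgebra.lift_of _ _
  let l0 : MonoidAlgebra ℂ G →ₗ[ℂ] ℂ :=
    LinearMap.proj 1 ∘ₗ LinearMap.applyₗ f ∘ₗ L.toLinearMap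
  let l : K →ₗ[ℂ] ℂ := (I.restrictScalars ℂ).liftQ l0 (fun k hk => by
      have hk' : L k f = 0 := hk
      simp [l0, hk']) ∘ₗ (Submodule.Quotient.restrictScalarsEquiv ℂ I).symm.toLinearMap
  have hl (g : G) : l (σ g) = f g := by
    change L (MonoidAlgebra.of ℂ G g) f 1 = f g
    rw [hLof, shift_apply, one_mul]
  have : Nontrivial K := Ideal.Quotient.nontrivial_iff.2 fun h => hf0 <| by
    have : (1 : MonoidAlgebra ℂ G) ∈ I := h ▸ Submodule.mem_top
    simpa [I] using this
  have hnil (g : G) : IsNilpotent (σ g - algebraMap ℂ K (χ g)) := by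
    obtain ⟨k, hk⟩ := mem_weightSpace.1 hf g
    refine ⟨k, ?_⟩
    change (Ideal.Quotient.mk I (MonoidAlgebra.of ℂ G g) -
      Ideal.Quotient.mk I (algebraMap ℂ _ (χ g))) ^ k = 0
    rw [← map_sub, ← map_pow, Ideal.Quotient.eq_zero_iff_mem]
    change L _ f = 0
    rw [map_pow, map_sub, hLof, AlgHom.commutes, Algebra.algebraMap_eq_smul_one, hk]
  have hscalar {a : ℂ} (h : IsNilpotent (algebraMap ℂ K a)) : a = 0 := by
    rw [IsNilpotent.map_iff (algebraMap ℂ K).injective] at h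
    exact h.eq_zero
  have hχ0 (g : G) : χ g ≠ 0 := fun h => by
    have h1 := hnil g
    rw [h, map_zero, sub_zero] at h1
    have h2 : IsUnit (σ g) := (Group.isUnit g).map σ
    exact h1.not_isUnit h2
  -- Modulo nilpotents `σ g` equals `χ g`, so the difference is a nilpotent scalar, which is zero
  -- because `K` is nontrivial.
  have hχ_mul (g h : G) : χ (g * h) = χ g * χ h := by
    rw [← sub_eq_zero]
    refine hscalar ?_
    have : algebraMap ℂ K (χ (g * h) - χ g * χ h) = (σ g * (σ h - algebraMap ℂ K (χ h)) +
        algebraMap ℂ K (χ h) * (σ g - algebraMap ℂ K (χ g))) -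
        (σ (g * h) - algebraMap ℂ K (χ (g * h))) := by
      rw [map_sub, map_mul, map_mul]; ring
    rw [this]
    exact (Commute.all _ _).isNilpotent_sub
      ((Commute.all _ _).isNilpotent_add ((Commute.all _ _).isNilpotent_mul_left (hnil h))
        ((Commute.all _ _).isNilpotent_mul_left (hnil g))) (hnil _)
  have hχ1 : χ 1 = 1 := mul_left_cancel₀ (hχ0 1) (by rw [← hχ_mul, mul_one, mul_one])
  let χ' : G →* ℂ := ⟨⟨χ, hχ1⟩, hχ_mul⟩
  let ψ : G →* ℂˣ := χ'.toHomUnits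
  have hψ (g : G) : (ψ g : ℂ) = χ g := rfl
  -- Twisting by the inverse character makes the representation unipotent.
  let τ : G →* K := σ * ((algebraMap ℂ K : ℂ →* K).comp ((Units.coeHom ℂ).comp ψ⁻¹))
  have hτ (g : G) : τ g = σ g * algebraMap ℂ K (χ g)⁻¹ := by
    simp [τ, hψ]
  obtain ⟨P, hP⟩ := c.exists_of_unipotent τ (fun g => by
    have : τ g - 1 = algebraMap ℂ K (χ g)⁻¹ * (σ g - algebraMap ℂ K (χ g)) := by
      rw [hτ, mul_sub, ← map_mul, inv_mul_cancel₀ (hχ0 g), map_one, mul_comm]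
    rw [this]
    exact (Commute.all _ _).isNilpotent_mul_left (hnil g)) l
  refine ⟨P, ψ, fun g => ?_⟩
  rw [← hP, hτ, mul_comm (σ g), ← Algebra.smul_def, map_smul, hl, hψ, smul_eq_mul, mul_right_comm,
    inv_mul_cancel₀ (hχ0 g), one_mul]

end Functions

/-! ### Dense homomorphisms to `𝔾ₐᵐ × T` and regular functions as functions on `G`. -/

section ProductRepresentation

variable {G : Type u} [CommGroup G] {m : ℕ} (c : Coordinates G m)

/-- The homomorphism from `G` to the points of `𝔾ₐᵐ` given by coordinates on `G`. -/
def Coordinates.vecHom : G →* Points (VecCoord m) ℂ :=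
  (VecCoord.pointsEquiv m ℂ).symm.toMonoidHom.comp
    { toFun := fun g => .ofAdd (c.val g)
      map_one' := by
        have h : c.x 1 = 0 := by simpa using c.x_mul 1 1
        rw [← ofAdd_zero]
        congr 1
        ext i
        simp [Coordinates.val, h]
      map_mul' := fun g h => by
        rw [← ofAdd_add]
        congr 1
        ext i
        simp [Coordinates.val, c.x_mul] }

variable {B : Type v} [CommRing B] [HopfAlgebra ℂ B] (ρ : G →* Points B ℂ)

/-- The homomorphism from `G` to the points of `𝔾ₐᵐ × T` given by coordinates on `G` and a
homomorphism to the points of `T`. -/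
def Coordinates.prodHom : G →* Points (VecCoord m ⊗[ℂ] B) ℂ :=
  (Points.prodEquiv (VecCoord m) B ℂ).symm.toMonoidHom.comp (c.vecHom.prod ρ)

@[simp]
theorem Coordinates.prodHom_eval_tmul (g : G) (P : VecCoord m) (b : B) :
    (c.prodHom ρ g).eval (P ⊗ₜ b) = VecCoord.aeval (c.val g) P * (ρ g).eval b :=
  Points.prodEquiv_symm_eval_tmul _ _ _

/-- The character of `G` given by a character of `T`. -/
def characterOf (b : GroupLike ℂ B) : G →* ℂ where
  toFun g := (ρ g).eval b
  map_one' := by rw [map_one, Points.eval_one_apply]; simp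
  map_mul' g h := by rw [map_mul, Points.eval_mul_apply]; simp

@[simp]
theorem characterOf_apply (b : GroupLike ℂ B) (g : G) : characterOf ρ b g = (ρ g).eval b := rfl

variable {ρ}

/-- Expand `z = ∑ Pₖ ⊗ k` in the basis of group-like elements. Density of `ρ` makes their characters
distinct, so the functions `Pₖ · k` lie in independent weight spaces and vanish separately; then
`Pₖ` vanishes on `ℤᵐ`. -/
theorem Coordinates.isZariskiDense_prodHom (hρ : IsZariskiDense ρ)
    (hB : Submodule.span ℂ {b : B | IsGroupLikeElem ℂ b} = ⊤) : IsZariskiDense (c.prodHom ρ) := by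
  classical
  have hspan : ⊤ ≤ Submodule.span ℂ (Set.range (GroupLike.val (R := ℂ) (A := B))) := by
    rw [← hB]
    exact Submodule.span_mono fun b hb => ⟨⟨b, hb⟩, rfl⟩
  let b := Module.Basis.mk linearIndep_groupLikeVal hspan
  intro z hz
  let e := TensorProduct.equivFinsuppOfBasisRight (M := VecCoord m) b
  have hsum : z = (e z).sum fun k P => P ⊗ₜ b k := by
    rw [← TensorProduct.equivFinsuppOfBasisRight_symm_apply, LinearEquiv.symm_apply_apply]
  let F (k : GroupLike ℂ B) : G → ℂ :=
    (fun g => VecCoord.aeval (c.val g) (e z k)) * characterOf ρ k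
  have hF (k) : F k ∈ weightSpace (characterOf ρ k) := by
    have := mul_mem_weightSpace (c.aeval_mem_weightSpace (e z k))
      (character_mem_weightSpace (characterOf ρ k))
    rwa [one_mul] at this
  have hinj : Function.Injective fun k : GroupLike ℂ B => (characterOf ρ k : G → ℂ) :=
    fun k l h => GroupLike.val_injective (hρ.eq_of_eval_eq fun g => congrFun h g)
  have h0 : ∑ k ∈ (e z).support, F k = 0 := by
    ext g
    have h1 := hz g
    rw [hsum, Finsupp.sum, map_sum] at h1
    simpa [F, b] using h1
  have hF0 := (iSupIndep_iff_finsetSum_eq_zero_imp_eq_zero _).1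
    (iSupIndep_weightSpace.comp hinj) _ F (fun k _ => hF k) h0
  rw [← e.map_eq_zero_iff]
  ext k : 1
  by_contra hk
  refine hk (VecCoord.eq_zero_of_aeval_int fun n => ?_)
  have h1 := congrFun (hF0 k (Finsupp.mem_support_iff.2 hk)) (∏ i, c.e i ^ n i)
  have h2 : characterOf ρ k (∏ i, c.e i ^ n i) ≠ 0 :=
    ((Group.isUnit (∏ i, c.e i ^ n i)).map (characterOf ρ k)).ne_zero
  have h3 : c.val (∏ i, c.e i ^ n i) = fun i => (n i : ℂ) := by
    funext i
    rw [Coordinates.val, c.x_prod]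
  have h4 : F k (∏ i, c.e i ^ n i) = VecCoord.aeval (c.val (∏ i, c.e i ^ n i)) (e z k) *
    characterOf ρ k (∏ i, c.e i ^ n i) := rfl
  rw [h4, h3] at h1
  exact (mul_eq_zero.1 h1).resolve_right h2

variable (G) in
/-- The group of characters of `G`. -/
def CharGroup : Type u := G →* ℂˣ

instance : CommGroup (CharGroup G) := inferInstanceAs (CommGroup (G →* ℂˣ))

/-- The value of a character. -/
def CharGroup.apply (ψ : CharGroup G) : G →* ℂ := (Units.coeHom ℂ).comp (show G →* ℂˣ from ψ)

variable (G) in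
/-- The coordinate ring of the diagonalizable group whose characters are all characters of `G`. -/
abbrev CharCoord : Type u := MonoidAlgebra ℂ (CharGroup G)

variable (G) in
/-- The canonical homomorphism from `G` to the diagonalizable group whose characters are all
characters of `G`. -/
def charHom : G →* Points (CharCoord G) ℂ :=
  (MonoidAlgebra.liftMulEquiv (R := ℂ) (M := CharGroup G) (A := ℂ)).toMonoidHom.comp
    { toFun := fun g => ⟨⟨fun ψ => ψ.apply g, rfl⟩, fun _ _ => rfl⟩
      map_one' := by ext ψ; exact map_one ψ.apply
      map_mul' := fun g h => by ext ψ; exact map_mul ψ.apply g h }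

theorem charHom_eval (g : G) (x : CharCoord G) :
    (charHom G g).eval x = x.coeff.sum fun ψ a => a * ψ.apply g :=
  MonoidAlgebra.lift_apply _ _

@[simp]
theorem charHom_eval_single (g : G) (ψ : CharGroup G) (a : ℂ) :
    (charHom G g).eval (MonoidAlgebra.single ψ a) = a * ψ.apply g := by
  rw [charHom_eval]
  simp

-- This is Dedekind's linear independence of characters.
variable (G) in
theorem isZariskiDense_charHom : IsZariskiDense (charHom G) := by
  intro x hx
  have h1 := (linearIndependent_monoidHom G ℂ).comp (CharGroup.apply (G := G)) fun ψ ψ' h =>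
    MonoidHom.ext fun g => Units.ext congr($h g)
  refine MonoidAlgebra.coeff_injective ?_
  refine linearIndependent_iff.1 h1 _ ?_
  ext g
  have := hx g
  rw [charHom_eval] at this
  rw [Finsupp.linearCombination_apply, Finsupp.sum, Finset.sum_apply]
  exact this

/-- The product of `𝔾ₐᵐ` and the diagonalizable group whose characters are all characters of `G`
contains a dense image of `G`. -/
theorem Coordinates.isZariskiDense_prodHom_charHom : IsZariskiDense (c.prodHom (charHom G)) :=
  c.isZariskiDense_prodHom (isZariskiDense_charHom G) MonoidAlgebra.span_isGroupLikeElem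

/-- A function on `G` whose translates span a finite dimensional space is a regular function on the
product of `𝔾ₐᵐ` and the diagonalizable group whose characters are all characters of `G`. -/
theorem Coordinates.exists_eval_eq_of_finiteDimensional (W : Submodule ℂ (G → ℂ))
    [FiniteDimensional ℂ W] (hW : ∀ g, ∀ f ∈ W, shift G g f ∈ W) {f : G → ℂ} (hf : f ∈ W) :
    ∃ z, ∀ g, (c.prodHom (charHom G) g).eval z = f g := by
  let ev : VecCoord m ⊗[ℂ] CharCoord G →ₐ[ℂ] (G → ℂ) :=
    AlgHom.pi fun g => (c.prodHom (charHom G) g).eval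
  suffices h : f ∈ LinearMap.range ev.toLinearMap by
    obtain ⟨z, hz⟩ := h
    exact ⟨z, fun g => congrFun hz g⟩
  let T (g : G) : Module.End ℂ W := (shift G g).restrict (hW g)
  -- Commuting operators on a finite dimensional complex space: `W` is spanned by simultaneous
  -- generalized eigenvectors.
  have htop := Module.End.iSup_iInf_maxGenEigenspace_eq_top_of_iSup_maxGenEigenspace_eq_top_of_commute
    T (fun g h _ => LinearMap.ext fun f => Subtype.ext congr($(shift_commute g h) f.1))
    fun g => Module.End.iSup_maxGenEigenspace_eq_top _
  suffices h : ⊤ ≤ (LinearMap.range ev.toLinearMap).comap W.subtype from h (x := ⟨f, hf⟩) trivial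
  rw [← htop]
  refine iSup_le fun χ f' hf' => ?_
  have hw : f'.1 ∈ weightSpace χ := by
    refine (Submodule.mem_iInf _).2 fun g => ?_
    have h1 := (Submodule.mem_iInf _).1 hf' g
    have h2 := (Module.End.genEigenspace_restrict (shift G g) W ⊤ (χ g) (hW g)).le h1
    exact h2
  rw [Submodule.mem_comap]
  by_cases h0 : f'.1 = 0
  · rw [Submodule.subtype_apply, h0]
    exact Submodule.zero_mem _
  obtain ⟨P, ψ, h⟩ := c.eq_aeval_mul_of_mem_weightSpace hw h0
  refine ⟨P ⊗ₜ MonoidAlgebra.single (show CharGroup G from ψ) 1, ?_⟩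
  ext g
  refine (c.prodHom_eval_tmul _ _ _ _).trans ?_
  rw [charHom_eval_single, one_mul]
  exact (h g).symm

/-- The function on `G` given by a regular function on an affine group is a regular function on the
product of `𝔾ₐᵐ` and the diagonalizable group whose characters are all characters of `G`. -/
theorem Coordinates.exists_eval_eq {A : Type v} [CommRing A] [HopfAlgebra ℂ A] (φ : G →* Points A ℂ)
    (a : A) : ∃ z, ∀ g, (c.prodHom (charHom G) g).eval z = (φ g).eval a := by
  let ev : A →ₐ[ℂ] (G → ℂ) := AlgHom.pi fun g => (φ g).eval
  let r := ℛ ℂ a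
  let W : Submodule ℂ (G → ℂ) := Submodule.span ℂ (Set.range fun g => shift G g (ev a))
  -- From `a(xg) = ∑ a₍₁₎(x) a₍₂₎(g)`, all translates lie in the span of the finitely many left
  -- factors.
  have hW : W ≤ Submodule.span ℂ ((fun i => ev (r.left i)) '' r.index) := by
    refine Submodule.span_le.2 ?_
    rintro _ ⟨g, rfl⟩
    have h : shift G g (ev a) = ∑ i ∈ r.index, (φ g).eval (r.right i) • ev (r.left i) := by
      ext x
      have h1 : ev a (x * g) = (φ (x * g)).eval a := rfl
      rw [shift_apply, h1, map_mul, Points.eval_mul_apply, ← r.eq, map_sum, Finset.sum_apply]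
      exact Finset.sum_congr rfl fun i _ => by
        simp [ev, mul_comm]
    change shift G g (ev a) ∈ _
    rw [h]
    exact Submodule.sum_mem _ fun i hi => Submodule.smul_mem _ _ (Submodule.subset_span ⟨i, hi, rfl⟩)
  have : FiniteDimensional ℂ (Submodule.span ℂ ((fun i => ev (r.left i)) '' r.index)) :=
    FiniteDimensional.span_of_finite ℂ (r.index.finite_toSet.image _)
  have : FiniteDimensional ℂ W := Submodule.finiteDimensional_of_le hW
  refine c.exists_eval_eq_of_finiteDimensional W (fun g f hf => ?_) (f := ev a)
    (Submodule.subset_span ⟨1, by simp⟩)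
  suffices W ≤ W.comap (shift G g) from this hf
  refine Submodule.span_le.2 ?_
  rintro _ ⟨h, rfl⟩
  refine Submodule.subset_span ⟨g * h, ?_⟩
  simp only [map_mul]
  rfl

end ProductRepresentation

/-! ### Homomorphisms from diagonalizable to unipotent groups. -/

section Unipotent

/-- Group elements are group-like. Hence the `γ`-coefficients of a multiplicative matrix form an
idempotent matrix, the projector to the weight space of `γ`. -/
theorem coeff_tmul_coeff_comul {Γ : Type*} (γ : Γ) (x : MonoidAlgebra ℂ Γ) :
    LinearMap.mul' ℂ ℂ (TensorProduct.map
      (Finsupp.lapply γ ∘ₗ (MonoidAlgebra.coeffLinearEquiv ℂ).toLinearMap)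
      (Finsupp.lapply γ ∘ₗ (MonoidAlgebra.coeffLinearEquiv ℂ).toLinearMap)
      (Coalgebra.comul (R := ℂ) x)) = x.coeff γ := by
  classical
  induction x using MonoidAlgebra.induction_linear with
  | zero => simp
  | add x y hx hy => rw [map_add, map_add, map_add, hx, hy]; rfl
  | single δ a =>
    by_cases h : δ = γ <;> simp [MonoidAlgebra.comul_single, h]

variable {Γ : Type*} [CommGroup Γ]

/-- A homomorphism from a diagonalizable group to a unipotent group is trivial. -/
theorem IsUnipotent.bialgHom_eq {C : Type v} [CommRing C] [HopfAlgebra ℂ C] (hC : IsUnipotent C)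
    (f : C →ₐc[ℂ] MonoidAlgebra ℂ Γ) (x : C) : f x = algebraMap ℂ _ (Coalgebra.counit (R := ℂ) x) := by
  obtain ⟨n, M, hd, hl, hcomul, hcounit, hgen⟩ := hC
  have hidem (γ : Γ) (i j : Fin n) :
      (f (M i j)).coeff γ = ∑ k, (f (M i k)).coeff γ * (f (M k j)).coeff γ := by
    rw [← coeff_tmul_coeff_comul, ← CoalgHomClass.map_comp_comul_apply, hcomul, map_sum, map_sum,
      map_sum]
    simp
  -- For `γ ≠ 1` this idempotent is strictly upper triangular, hence zero; the induction runs over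
  -- columns.
  have hzero (γ : Γ) (hγ : γ ≠ 1) (i j : Fin n) : (f (M i j)).coeff γ = 0 := by
    induction j using WellFoundedLT.induction with
    | ind j ih =>
      rw [hidem]
      refine Finset.sum_eq_zero fun k _ => ?_
      rcases lt_trichotomy k j with h | rfl | h
      · rw [ih k h, zero_mul]
      · rw [hd, map_one, MonoidAlgebra.one_def]
        simp [hγ.symm]
      · rw [hl k j h, map_zero]
        simp
  have key : (f : C →ₐ[ℂ] MonoidAlgebra ℂ Γ) =
      (Algebra.ofId ℂ _).comp (Bialgebra.counitAlgHom ℂ C) := by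
    refine AlgHom.ext_of_adjoin_eq_top hgen ?_
    rintro _ ⟨⟨i, j⟩, rfl⟩
    have h1 : f (M i j) = MonoidAlgebra.single 1 ((f (M i j)).coeff 1) := by
      refine MonoidAlgebra.coeff_injective (Finsupp.ext fun γ => ?_)
      by_cases hγ : γ = 1
      · subst hγ; simp
      · rw [hzero γ hγ]
        simp [Ne.symm hγ]
    have h2 : Coalgebra.counit (R := ℂ) (f (M i j)) = Coalgebra.counit (R := ℂ) (M i j) :=
      CoalgHomClass.counit_comp_apply f _
    change f (M i j) = algebraMap ℂ _ (Coalgebra.counit (R := ℂ) (M i j))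
    rw [← h2, h1, MonoidAlgebra.counit_single]
    simp
  exact congr($key x)

/-- A homomorphism of affine groups factors through a closed subgroup if its comorphism kills the
ideal of the subgroup. -/
theorem exists_bialgHom_comp_eq {A : Type*} {C : Type*} {Q : Type*} [CommRing A] [Bialgebra ℂ A]
    [CommRing C] [Bialgebra ℂ C] [CommRing Q] [Bialgebra ℂ Q] (q : A →ₐc[ℂ] C)
    (hq : Function.Surjective q) (f : A →ₐc[ℂ] Q) (h : ∀ a, q a = 0 → f a = 0) :
    ∃ f' : C →ₐc[ℂ] Q, ∀ a, f' (q a) = f a := by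
  let f' : C →ₐ[ℂ] Q := AlgHom.liftOfSurjective (q : A →ₐ[ℂ] C) hq (f : A →ₐ[ℂ] Q) h
  have hf' (a : A) : f' (q a) = f a := AlgHom.liftOfSurjective_apply ..
  refine ⟨.ofAlgHom f' ?_ ?_, hf'⟩
  · refine AlgHom.ext fun x => ?_
    obtain ⟨a, rfl⟩ := hq x
    change Coalgebra.counit (R := ℂ) (f' (q a)) = Coalgebra.counit (R := ℂ) (q a)
    rw [hf', CoalgHomClass.counit_comp_apply, CoalgHomClass.counit_comp_apply]
  · refine AlgHom.ext fun x => ?_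
    obtain ⟨a, rfl⟩ := hq x
    change Algebra.TensorProduct.map f' f' (Coalgebra.comul (R := ℂ) (q a)) =
      Coalgebra.comul (R := ℂ) (f' (q a))
    rw [hf', ← CoalgHomClass.map_comp_comul_apply, ← CoalgHomClass.map_comp_comul_apply,
      ← (ℛ ℂ a).eq]
    simp [hf']

end Unipotent

/-! ### Homomorphisms out of a group with dense image of `G`. -/

section Lift

variable {G : Type*} [Group G] {A : Type u} [CommRing A] [HopfAlgebra ℂ A]
  {E : Type v} [CommRing E] [HopfAlgebra ℂ E]

/-- If the functions on `G` given by an affine group `S` are among those given by an affine group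
`S'` in which `G` is dense, there is a homomorphism `S' → S` compatible with the homomorphisms
from `G`. -/
theorem IsZariskiDense.exists_bialgHom {ψ : G →* Points E ℂ} (hψ : IsZariskiDense ψ)
    (φ : G →* Points A ℂ) (h : ∀ a, ∃ z, ∀ g, (ψ g).eval z = (φ g).eval a) :
    ∃ f : A →ₐc[ℂ] E, ∀ g a, (ψ g).eval (f a) = (φ g).eval a := by
  choose f hf using h
  have ext {a b : E} (h : ∀ g, (ψ g).eval a = (ψ g).eval b) : a = b := hψ.eq_of_eval_eq h
  let F : A →ₐ[ℂ] E :=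
    { toFun := f
      map_one' := ext fun g => by rw [hf, map_one, map_one]
      map_mul' := fun a b => ext fun g => by rw [hf, map_mul, map_mul, hf, hf]
      map_zero' := ext fun g => by rw [hf, map_zero, map_zero]
      map_add' := fun a b => ext fun g => by rw [hf, map_add, map_add, hf, hf]
      commutes' := fun r => ext fun g => by rw [hf, AlgHom.commutes, AlgHom.commutes] }
  exact ⟨hψ.bialgHom φ F fun g a => hf a g, fun g a => hf a g⟩

end Lift

theorem IsDiagonalizable.span_isGroupLikeElem {B : Type v} [CommRing B] [HopfAlgebra ℂ B]
    (hB : IsDiagonalizable B) : Submodule.span ℂ {b : B | IsGroupLikeElem ℂ b} = ⊤ := by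
  obtain ⟨n, f, hf⟩ := hB
  have h := congrArg (Submodule.map (f : AddMonoidAlgebra ℂ (Fin n → ℤ) →ₐ[ℂ] B).toLinearMap)
    (AddMonoidAlgebra.span_isGroupLikeElem (R := ℂ) (A := ℂ) (G := Fin n → ℤ))
  rw [Submodule.map_span, Submodule.map_top,
    LinearMap.range_eq_top.2 (show Function.Surjective
      (f : AddMonoidAlgebra ℂ (Fin n → ℤ) →ₐ[ℂ] B).toLinearMap from hf)] at h
  rw [eq_top_iff, ← h]
  refine Submodule.span_mono ?_
  rintro _ ⟨x, hx, rfl⟩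
  exact IsGroupLikeElem.map f hx

theorem IsDiagonalizable.finiteType {B : Type v} [CommRing B] [HopfAlgebra ℂ B]
    (hB : IsDiagonalizable B) : Algebra.FiniteType ℂ B := by
  obtain ⟨n, f, hf⟩ := hB
  have : AddMonoid.FG (Fin n → ℤ) := AddGroup.fg_iff_addMonoid_fg.1 inferInstance
  exact .of_surjective (f : AddMonoidAlgebra ℂ (Fin n → ℤ) →ₐ[ℂ] B) hf

/-! ### Extensions of `T` by unipotent groups involve only characters of `T`. -/

section Universal

variable {G : Type u} [CommGroup G] {m : ℕ} (c : Coordinates G m)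
  {B : Type v} [CommRing B] [HopfAlgebra ℂ B] (ρ : G →* Points B ℂ)

/-- The characters of `G` that are given by characters of `T`. -/
def algebraicCharacters : Subgroup (CharGroup G) where
  carrier := {ψ | ∃ b : GroupLike ℂ B, ψ.apply = characterOf ρ b}
  one_mem' := ⟨1, by ext g; exact (map_one (ρ g).eval).symm⟩
  mul_mem' := by
    rintro ψ ψ' ⟨b, hb⟩ ⟨b', hb'⟩
    refine ⟨b * b', MonoidHom.ext fun g => ?_⟩
    have h : (ψ * ψ').apply g = ψ.apply g * ψ'.apply g := rfl
    rw [h, hb, hb']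
    exact (map_mul (ρ g).eval _ _).symm
  inv_mem' := by
    rintro ψ ⟨b, hb⟩
    refine ⟨b⁻¹, MonoidHom.ext fun g => ?_⟩
    have h : ψ⁻¹.apply g * ψ.apply g = 1 :=
      congrArg Units.val (inv_mul_cancel ((show G →* ℂˣ from ψ) g))
    have h' : characterOf ρ b⁻¹ g * ψ.apply g = 1 := by
      rw [hb, characterOf_apply, characterOf_apply, ← map_mul, ← GroupLike.val_mul, inv_mul_cancel,
        GroupLike.val_one, map_one]
    have h0 : ψ.apply g ≠ 0 := right_ne_zero_of_mul_eq_one h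
    exact mul_right_cancel₀ h0 (h.trans h'.symm)

/-- The characters of `G` modulo those given by characters of `T`. -/
abbrev CharQuotient : Type u := CharGroup G ⧸ algebraicCharacters ρ

/-- The comorphism of the homomorphism to `𝔾ₐᵐ × D(CharGroup G)` from its closed subgroup
`D(CharQuotient ρ)`. -/
def toCharQuotient (m : ℕ) : VecCoord m ⊗[ℂ] CharCoord G →ₐc[ℂ] MonoidAlgebra ℂ (CharQuotient ρ) :=
  ((Bialgebra.TensorProduct.lid ℂ (MonoidAlgebra ℂ (CharQuotient ρ))) :
      ℂ ⊗[ℂ] MonoidAlgebra ℂ (CharQuotient ρ) →ₐc[ℂ] _).comp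
    (Bialgebra.TensorProduct.map (Bialgebra.counitBialgHom ℂ (VecCoord m))
      (MonoidAlgebra.mapDomainBialgHom ℂ (QuotientGroup.mk' (algebraicCharacters ρ))))

@[simp]
theorem toCharQuotient_tmul_single (P : VecCoord m) (ψ : CharGroup G) (a : ℂ) :
    toCharQuotient ρ m (P ⊗ₜ MonoidAlgebra.single ψ a) =
      Coalgebra.counit (R := ℂ) P • MonoidAlgebra.single (ψ : CharQuotient ρ) a := by
  have h := MonoidAlgebra.mapDomainBialgHom_single (R := ℂ)
    (QuotientGroup.mk' (algebraicCharacters ρ)) ψ a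
  change Coalgebra.counit (R := ℂ) P • MonoidAlgebra.mapDomainBialgHom ℂ _ _ = _
  rw [h]
  rfl

/-- The coefficient of the neutral element. -/
def coeffOne (Γ : Type*) [CommGroup Γ] : MonoidAlgebra ℂ Γ →ₗ[ℂ] ℂ :=
  Finsupp.lapply 1 ∘ₗ (MonoidAlgebra.coeffLinearEquiv ℂ).toLinearMap

/-- The projection to the functions on `𝔾ₐᵐ × D(CharGroup G)` whose characters are algebraic. -/
def algebraicPart (m : ℕ) : VecCoord m ⊗[ℂ] CharCoord G →ₗ[ℂ] VecCoord m ⊗[ℂ] CharCoord G :=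
  (TensorProduct.rid ℂ _).toLinearMap ∘ₗ
    LinearMap.lTensor _ (coeffOne (CharQuotient ρ) ∘ₗ (toCharQuotient ρ m : _ →ₗ[ℂ] _)) ∘ₗ
      Coalgebra.comul

-- The coefficient of `1` is integration over the diagonalizable group of `CharQuotient ρ`, so
-- `algebraicPart` averages over translations by it: `ψ` survives exactly when its class is trivial.
open Classical in
theorem algebraicPart_tmul_single (P : VecCoord m) (ψ : CharGroup G) :
    algebraicPart ρ m (P ⊗ₜ MonoidAlgebra.single ψ 1) =
      if ψ ∈ algebraicCharacters ρ then P ⊗ₜ MonoidAlgebra.single ψ 1 else 0 := by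
  have h (Q : VecCoord m) : coeffOne (CharQuotient ρ)
      (toCharQuotient ρ m (Q ⊗ₜ MonoidAlgebra.single ψ 1)) =
        if ψ ∈ algebraicCharacters ρ then Coalgebra.counit (R := ℂ) Q else 0 := by
    rw [toCharQuotient_tmul_single, ← QuotientGroup.eq_one_iff]
    split_ifs with h <;> simp [coeffOne, h]
  have hP := Coalgebra.sum_tmul_counit_eq (ℛ ℂ P)
  replace hP := congrArg (TensorProduct.rid ℂ _) hP
  rw [map_sum] at hP
  simp only [TensorProduct.rid_tmul, one_smul] at hP
  have h2 : algebraicPart ρ m (P ⊗ₜ MonoidAlgebra.single ψ 1) =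
      ∑ i ∈ (ℛ ℂ P).index, coeffOne (CharQuotient ρ)
        (toCharQuotient ρ m ((ℛ ℂ P).right i ⊗ₜ MonoidAlgebra.single ψ 1)) •
          ((ℛ ℂ P).left i ⊗ₜ[ℂ] MonoidAlgebra.single ψ 1) := by
    simp only [algebraicPart, LinearMap.comp_apply]
    rw [TensorProduct.comul_tmul, ← (ℛ ℂ P).eq, MonoidAlgebra.comul_single]
    simp [TensorProduct.sum_tmul, map_sum]
  rw [h2]
  simp_rw [h]
  split_ifs
  · conv_rhs => rw [← hP, TensorProduct.sum_tmul]
    simp [TensorProduct.smul_tmul']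
  · simp

variable {ρ}

theorem algebraicPart_eval (z : VecCoord m ⊗[ℂ] CharCoord G) :
    ∃ y : VecCoord m ⊗[ℂ] B, ∀ g,
      (c.prodHom ρ g).eval y = (c.prodHom (charHom G) g).eval (algebraicPart ρ m z) := by
  classical
  induction z using TensorProduct.induction_on with
  | zero => exact ⟨0, by simp⟩
  | add z z' h h' =>
    obtain ⟨y, hy⟩ := h
    obtain ⟨y', hy'⟩ := h'
    exact ⟨y + y', fun g => by rw [map_add, map_add, map_add, hy, hy']⟩
  | tmul P x =>
    induction x using MonoidAlgebra.induction_linear with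
    | zero => exact ⟨0, by simp⟩
    | add z z' h h' =>
      obtain ⟨y, hy⟩ := h
      obtain ⟨y', hy'⟩ := h'
      exact ⟨y + y', fun g => by rw [map_add, TensorProduct.tmul_add, map_add, map_add, hy, hy']⟩
    | single ψ a =>
      have h1 : P ⊗ₜ[ℂ] MonoidAlgebra.single ψ a = (a • P) ⊗ₜ MonoidAlgebra.single ψ 1 := by
        rw [TensorProduct.smul_tmul, MonoidAlgebra.smul_single, smul_eq_mul, mul_one]
      rw [h1, algebraicPart_tmul_single]
      split_ifs with hψ
      · obtain ⟨b, hb⟩ := hψ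
        refine ⟨(a • P) ⊗ₜ (b : B), fun g => ?_⟩
        rw [c.prodHom_eval_tmul, c.prodHom_eval_tmul, charHom_eval_single, hb, one_mul,
          characterOf_apply]
      · exact ⟨0, by simp⟩

/-- A regular function on an extension of `T` by a unipotent group gives the same function on `G` as
a regular function on `𝔾ₐᵐ × T`. -/
theorem Coordinates.exists_prodHom_eval_eq (hB : Submodule.span ℂ {b : B | IsGroupLikeElem ℂ b} = ⊤)
    {A : Type v} [CommRing A] [HopfAlgebra ℂ A] (φ : G →* Points A ℂ) (p : B →ₐc[ℂ] A)
    (hp : ∀ g, Points.comap p (φ g) = ρ g) {C : Type w} [CommRing C] [HopfAlgebra ℂ C]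
    {q : A →ₐc[ℂ] C} (hpq : IsExact p q) (hC : IsUnipotent C) (a : A) :
    ∃ y, ∀ g, (c.prodHom ρ g).eval y = (φ g).eval a := by
  have hd := c.isZariskiDense_prodHom_charHom
  obtain ⟨i, hi⟩ := hd.exists_bialgHom φ (c.exists_eval_eq φ)
  -- The comorphism of the composite from the kernel of `D → T` to `S`. It is trivial after
  -- projecting to `T`, so it factors through `U` and is trivial.
  let f := (toCharQuotient ρ m).comp i
  have hfp (b : B) : f (p b) = algebraMap ℂ _ (Coalgebra.counit (R := ℂ) b) := by
    have hle : (⊤ : Submodule ℂ B) ≤ LinearMap.eqLocus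
        (((f.comp p : B →ₐc[ℂ] _) : B →ₐ[ℂ] MonoidAlgebra ℂ (CharQuotient ρ)).toLinearMap)
        (Algebra.linearMap ℂ _ ∘ₗ Coalgebra.counit) := by
      rw [← hB]
      refine Submodule.span_le.2 fun b hb => ?_
      let ψ : CharGroup G := (characterOf ρ ⟨b, hb⟩).toHomUnits
      have hψ : ψ ∈ algebraicCharacters ρ := ⟨⟨b, hb⟩, rfl⟩
      have h1 : i (p b) = 1 ⊗ₜ MonoidAlgebra.single ψ 1 := by
        refine hd.eq_of_eval_eq fun g => ?_
        rw [hi, c.prodHom_eval_tmul, map_one, one_mul, charHom_eval_single, one_mul]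
        exact congr(($(hp g)).eval b)
      change toCharQuotient ρ m (i (p b)) = algebraMap ℂ _ (Coalgebra.counit (R := ℂ) b)
      rw [h1, toCharQuotient_tmul_single, (QuotientGroup.eq_one_iff ψ).2 hψ,
        hb.counit_eq_one, Bialgebra.counit_one, one_smul, map_one, MonoidAlgebra.one_def]
    exact hle (x := b) trivial
  have hker (x : A) (hx : q x = 0) : f x = 0 := by
    have h1 : x ∈ RingHom.ker (q : A →ₐ[ℂ] C) := hx
    rw [hpq.ker_eq] at h1
    refine (Ideal.map_le_iff_le_comap
      (K := RingHom.ker (f : A →ₐ[ℂ] MonoidAlgebra ℂ (CharQuotient ρ)))).2 (fun b hb => ?_) h1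
    change f (p b) = 0
    have hb' : Coalgebra.counit (R := ℂ) b = 0 := hb
    rw [hfp, hb', map_zero]
  obtain ⟨f', hf'⟩ := exists_bialgHom_comp_eq q hpq.surjective f hker
  have hf (x : A) : f x = algebraMap ℂ _ (Coalgebra.counit (R := ℂ) x) := by
    rw [← hf', hC.bialgHom_eq, CoalgHomClass.counit_comp_apply]
  -- Since `f` is the counit, averaging the pullback of `a` over the kernel does not change it.
  have hpart : algebraicPart ρ m (i a) = i a := by
    have h2 (x : A) : coeffOne (CharQuotient ρ) (toCharQuotient ρ m (i x)) =
        Coalgebra.counit (R := ℂ) x := by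
      change coeffOne (CharQuotient ρ) (f x) = _
      rw [hf]
      simp [coeffOne]
    simp only [algebraicPart, LinearMap.comp_apply]
    rw [← CoalgHomClass.map_comp_comul_apply, ← (ℛ ℂ a).eq]
    simp [map_sum, h2]
  obtain ⟨y, hy⟩ := algebraicPart_eval (ρ := ρ) c (i a)
  exact ⟨y, fun g => by rw [hy, hpart, hi]⟩

end Universal

/-! ### The initial solvable representation and the inverse limit. -/

section Completion

variable {B : Type v} [CommRing B] [HopfAlgebra ℂ B]

variable (B) in
/-- The comorphism of the inclusion `𝔾ₐᵐ → 𝔾ₐᵐ × T`. -/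
def vecInclusion (m : ℕ) : VecCoord m ⊗[ℂ] B →ₐc[ℂ] VecCoord m :=
  ((Bialgebra.TensorProduct.rid ℂ ℂ (VecCoord m)) : VecCoord m ⊗[ℂ] ℂ →ₐc[ℂ] _).comp
    (Bialgebra.TensorProduct.map (BialgHom.id ℂ (VecCoord m)) (Bialgebra.counitBialgHom ℂ B))

theorem vecInclusion_tmul (m : ℕ) (P : VecCoord m) (b : B) :
    vecInclusion B m (P ⊗ₜ b) = Coalgebra.counit (R := ℂ) b • P := rfl

theorem isExact_inr_vecInclusion (m : ℕ) :
    IsExact (Points.inr (VecCoord m) B) (vecInclusion B m) where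
  injective := fun b b' h => by
    have h1 := congrArg (fun z => TensorProduct.lid ℂ B
      (TensorProduct.map (Coalgebra.counit (R := ℂ) (A := VecCoord m)) LinearMap.id z)) h
    simpa using h1
  surjective := fun P => ⟨P ⊗ₜ 1, by simp [vecInclusion_tmul]⟩
  ker_eq := by
    refine Eq.trans ?_ (Algebra.TensorProduct.lTensor_ker (R := ℂ) (A := VecCoord m)
      (Bialgebra.counitAlgHom ℂ B) (fun r => ⟨algebraMap ℂ B r, by simp⟩))
    ext z
    exact (Bialgebra.TensorProduct.rid ℂ ℂ (VecCoord m)).map_eq_zero_iff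

variable {G : Type u} [CommGroup G] {m : ℕ} (c : Coordinates G m) {ρ : G →* Points B ℂ}

/-- The universal solvable representation `𝔾ₐᵐ × T`. -/
def universalRep (hB : IsDiagonalizable B) (hρ : IsZariskiDense ρ) : SolvRep ρ where
  A := VecCoord m ⊗[ℂ] B
  finiteType :=
    have := hB.finiteType
    .trans (S := VecCoord m) inferInstance inferInstance
  φ := c.prodHom ρ
  dense := c.isZariskiDense_prodHom hρ hB.span_isGroupLikeElem
  p := Points.inr (VecCoord m) B
  comap_φ g := by
    ext b
    change (c.prodHom ρ g).eval (1 ⊗ₜ b) = _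
    rw [c.prodHom_eval_tmul, map_one, one_mul]
  exact_unipotent :=
    ⟨VecCoord m, inferInstance, inferInstance, vecInclusion B m, isExact_inr_vecInclusion m,
      VecCoord.isUnipotent⟩

theorem nonempty_universalRep_hom (hB : IsDiagonalizable B) (hρ : IsZariskiDense ρ)
    (S : SolvRep ρ) : Nonempty ((universalRep c hB hρ).Hom S) := by
  obtain ⟨C, _, _, q, hpq, hC⟩ := S.exact_unipotent
  have hd := c.isZariskiDense_prodHom hρ hB.span_isGroupLikeElem
  obtain ⟨f, hf⟩ := hd.exists_bialgHom S.φ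
    (c.exists_prodHom_eval_eq hB.span_isGroupLikeElem S.φ S.p S.comap_φ hpq hC)
  refine ⟨⟨f, fun g => Points.ext (hf g), fun b => hd.eq_of_eval_eq fun g => ?_⟩⟩
  refine (hf g _).trans ?_
  exact congr(($((S.comap_φ g).trans ((universalRep c hB hρ).comap_φ g).symm)).eval b)

/-- Both agree on the dense image of `G` in `S`. -/
theorem SolvRep.Hom.f_eq {S S' : SolvRep ρ} (h h' : S.Hom S') : h.f = h'.f := by
  refine BialgHom.ext fun a => S.dense.eq_of_eval_eq fun g => ?_
  exact congr(($((h.comap_φ g).trans (h'.comap_φ g).symm)).eval a)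

/-- The composition of homomorphisms of solvable representations. -/
def SolvRep.Hom.comp {S S' S'' : SolvRep ρ} (h' : S'.Hom S'') (h : S.Hom S') : S.Hom S'' where
  f := h.f.comp h'.f
  comap_φ g := by rw [← h'.comap_φ, ← h.comap_φ]; rfl
  comp_p b := by rw [BialgHom.comp_apply, h'.comp_p, h.comp_p]

/-- An initial solvable representation is the solvable completion. -/
def completionEquiv (S₀ : SolvRep ρ) (h : ∀ S, S₀.Hom S) (R : Type w) [CommRing R] [Algebra ℂ R] :
    Completion ρ R ≃* Points S₀.A R where
  toFun s := s.1 S₀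
  invFun x := ⟨fun S => Points.comap (h S).f x, fun S S' k => by
    change Points.comap (k.comp (h S)).f x = Points.comap (h S').f x
    rw [(h S').f_eq (k.comp (h S))]⟩
  left_inv s := Subtype.ext (funext fun S => s.2 S₀ S (h S))
  right_inv x := by
    have h1 : (h S₀).f = BialgHom.id ℂ S₀.A :=
      (h S₀).f_eq ⟨BialgHom.id ℂ S₀.A, fun _ => rfl, fun _ => rfl⟩
    change Points.comap (h S₀).f x = x
    rw [h1]
    rfl
  map_mul' _ _ := rfl

end Completion

end SolvComp

end

theorem mainTheorem10 {G : Type u} [CommGroup G] [Group.FG G]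
    {B : Type v} [CommRing B] [HopfAlgebra ℂ B] (hB : SolvComp.IsDiagonalizable B)
    (ρ : G →* SolvComp.Points B ℂ) (hρ : SolvComp.IsZariskiDense ρ) :
    ∃ e : ∀ (R : Type w) [CommRing R] [Algebra ℂ R],
        SolvComp.Completion ρ R ≃*
          Multiplicative (Fin (Module.finrank ℤ (Additive G)) → R) × SolvComp.Points B R,
      -- `e` is natural in `R`, hence an isomorphism of group functors
      (∀ (R R' : Type w) [CommRing R] [Algebra ℂ R] [CommRing R'] [Algebra ℂ R']
        (k : R →ₐ[ℂ] R') (s : SolvComp.Completion ρ R),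
        e R' (SolvComp.Completion.map ρ k s) =
          (Multiplicative.ofAdd (fun i => k ((e R s).1.toAdd i)),
            SolvComp.Points.map k (e R s).2)) ∧
      -- `e` is compatible with the projections to `T`
      (∀ (R : Type w) [CommRing R] [Algebra ℂ R] (s : SolvComp.Completion ρ R)
        (S : SolvComp.SolvRep ρ), SolvComp.Points.comap S.p (s.1 S) = (e R s).2) := by
  obtain ⟨c⟩ := SolvComp.Coordinates.nonempty G
  let S₀ := SolvComp.universalRep c hB hρ
  let h (S : SolvComp.SolvRep ρ) : S₀.Hom S :=
    (SolvComp.nonempty_universalRep_hom c hB hρ S).some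
  refine ⟨fun R _ _ => (SolvComp.completionEquiv S₀ h R).trans
    ((SolvComp.Points.prodEquiv _ B R).trans
      ((SolvComp.VecCoord.pointsEquiv _ R).prodCongr (MulEquiv.refl _))), ?_, ?_⟩
  · intro R R' _ _ _ _ k s
    rfl
  · intro R _ _ s S
    -- Compatibility of the family reduces the claim to `S₀`, whose projection to `T` is the second
    -- projection by construction.
    rw [← s.2 S₀ S (h S)]
    have h1 : (h S).f.comp S.p = S₀.p := BialgHom.ext (h S).comp_p
    change SolvComp.Points.comap ((h S).f.comp S.p) (s.1 S₀) = SolvComp.Points.comap S₀.p (s.1 S₀)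
    rw [h1]
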